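/- Let $d\in\mathbb N$, let $\Omega^\pm\subseteq\mathbb R^d$ be open convex sets, and let $c\in\mathscr C^2(\Omega^-\times\Omega^+)$ be infinitesimally twisted, i.e. the matrix $\nabla^2_{xy}c(x,y)=(\partial^2_{x_iy_j}c(x,y))_{1\le i,j\le d}$ is invertible for every $(x,y)\in\Omega^-\times\Omega^+$. Let $\mu^-,\mu^+$ be probability measures on $\mathbb R^d$ that are absolutely continuous with respect to Lebesgue measure with $L^\infty$ densities and whose supports $X^\pm=\operatorname{spt}\mu^\pm$ are compact and contained in $\Omega^\pm$. Let $\Pi(\mu^-,\mu^+)$ be the set of probability measures on $\mathbb R^d\times\mathbb R^d$ with marginals $\mu^-$ and $\mu^+$, and set $$v_0=\inf_{\gamma\in\Pi(\mu^-,\mu^+)}\int_{X^-\times X^+}c\,\mathrm d\gamma,\qquad v_\varepsilon=\inf_{\gamma\in\Pi(\mu^-,\mu^+)}\Big\{\int_{X^-\times X^+}c\,\mathrm d\gamma+\varepsilon\,\mathrm{Ent}(\gamma\,|\,\mu^-\otimes\mu^+)\Big\}\quad(\varepsilon>0),$$ where $\mathrm{Ent}(p\,|\,q)=\int\rho\log\rho\,\mathrm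 dq$ if $p=\rho q$, and $\mathrm{Ent}(p\,|\,q)=+\infty$ otherwise, is the relative entropy. Then there is a constant $m\in[0,\infty)$ such that for every $\varepsilon>0$ $$v_\varepsilon\ \ge\ v_0+\frac d2\,\varepsilon\log(1/\varepsilon)-m\,\varepsilon.$$ -/

import Mathlib

open MeasureTheory
open scoped ENNReal

noncomputable section

namespace EntropicOT

/-- The couplings of `μ` and `ν`: the measures on the product whose marginals are `μ` and `ν`
(they are probability measures as soon as `μ` is one). -/
def couplings {X Y : Type*} [MeasurableSpace X] [MeasurableSpace Y]
    (μ : Measure X) (ν : Measure Y) : Set (Measure (X × Y)) :=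
  {γ | γ.map Prod.fst = μ ∧ γ.map Prod.snd = ν}

/-- The optimal transport cost: the infimum over all couplings `γ` of the integral of `c` over
the product of the supports of the marginals. -/
def transportCost {X Y : Type*} [TopologicalSpace X] [MeasurableSpace X] [TopologicalSpace Y]
    [MeasurableSpace Y] (c : X × Y → ℝ) (μ : Measure X) (ν : Measure Y) : EReal :=
  ⨅ γ ∈ couplings μ ν, ((∫ z in μ.support ×ˢ ν.support, c z ∂γ : ℝ) : EReal)

/-- The entropic cost with parameter `ε`. The relative entropy of `γ` with respect to `μ ⊗ ν`,
with values in `[0, ∞]`, is Mathlib's Kullback-Leibler divergence. -/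
def entropicCost {X Y : Type*} [TopologicalSpace X] [MeasurableSpace X] [TopologicalSpace Y]
    [MeasurableSpace Y] (c : X × Y → ℝ) (μ : Measure X) (ν : Measure Y) (ε : ℝ) : EReal :=
  ⨅ γ ∈ couplings μ ν, (((∫ z in μ.support ×ˢ ν.support, c z ∂γ : ℝ) : EReal) +
    (ε : EReal) * ((InformationTheory.klDiv γ (μ.prod ν) : ℝ≥0∞) : EReal))

/-- The matrix of mixed second derivatives of `c` at `(x, y)`, with `(i, j)` entry
`∂²c / ∂xᵢ∂yⱼ`. -/
def crossHessian {d : ℕ} (c : EuclideanSpace ℝ (Fin d) × EuclideanSpace ℝ (Fin d) → ℝ)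
    (x y : EuclideanSpace ℝ (Fin d)) : Matrix (Fin d) (Fin d) ℝ :=
  Matrix.of fun i j =>
    fderiv ℝ (fun x' => fderiv ℝ (fun y' => c (x', y')) y (EuclideanSpace.single j 1)) x
      (EuclideanSpace.single i 1)

/-- `c` is infinitesimally twisted on `U × V`. -/
def InfinitesimallyTwisted {d : ℕ}
    (c : EuclideanSpace ℝ (Fin d) × EuclideanSpace ℝ (Fin d) → ℝ)
    (U V : Set (EuclideanSpace ℝ (Fin d))) : Prop :=
  ∀ x ∈ U, ∀ y ∈ V, IsUnit (crossHessian c x y)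

/-- `μ` is absolutely continuous with respect to Lebesgue measure, with an essentially bounded
density. -/
def HasBoundedDensity {d : ℕ} (μ : Measure (EuclideanSpace ℝ (Fin d))) : Prop :=
  ∃ f : EuclideanSpace ℝ (Fin d) → ℝ, MemLp f ∞ volume ∧ 0 ≤ᵐ[volume] f ∧
    μ = volume.withDensity fun x => ENNReal.ofReal (f x)

end EntropicOT

end

open scoped NNReal Topology CompactlySupported

/-! Kantorovich duality provides a coupling `γ₀` and, for each `η > 0`, potentials with `φ ⊕ ψ ≤ c`
on the supports and `∫ φ + ∫ ψ ≥ ∫ c dγ₀ - η`. Put `F = c - φ ⊕ ψ`. The Donsker–Varadhan bound with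
test function `-F / ε` gives, for every coupling `γ` of finite entropy, `∫ c dγ + ε Ent(γ) ≥ ∫ φ + ∫
ψ - ε log Z`, where `Z = ∫ exp (-F / ε) d(μ ⊗ ν)`. It remains to show `Z ≤ D ε ^ (d / 2)` with `D`
independent of the potentials, and then to let `η → 0`.

Since `F ≥ 0`, the sum `F (x, y) + F (x', y')` dominates the cross difference of `c`, in which the
potentials cancel (`exists_gibbsIntegralBound_ball`). Locally this difference is nearly the mixed
second derivative. Along the slices `x = v + T y`, with `T` the inverse transpose of the cross
Hessian, it is at least `‖y - y'‖² / 2`. Each slice therefore has a Gibbs integral of Gaussian size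
(`setLIntegral_exp_neg_div_le`), and `v` ranges over a bounded set. Compactness of the supports
makes the bound global. -/

namespace EntropicOT

/-! ### Kantorovich duality on compact spaces -/

section Duality

variable {X Y : Type*} [MetricSpace X] [CompactSpace X] [MeasurableSpace X]
  [MetricSpace Y] [CompactSpace Y] [MeasurableSpace Y]

/-- The values of the pairs of continuous potentials that dominate `f`. -/
def dominatingValues (μ : Measure X) (ν : Measure Y) (f : C(X × Y, ℝ)) : Set ℝ :=
  {r | ∃ (φ : C(X, ℝ)) (ψ : C(Y, ℝ)), (∀ x y, f (x, y) ≤ φ x + ψ y) ∧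
    ∫ x, φ x ∂μ + ∫ y, ψ y ∂ν = r}

/-- The value of the dual problem of maximal transport, a sublinear functional of `f`. -/
noncomputable def dualValue (μ : Measure X) (ν : Measure Y) (f : C(X × Y, ℝ)) : ℝ :=
  sInf (dominatingValues μ ν f)

theorem dominatingValues_nonempty (μ : Measure X) (ν : Measure Y) (f : C(X × Y, ℝ)) :
    (dominatingValues μ ν f).Nonempty :=
  ⟨_, ContinuousMap.const X ‖f‖, 0, fun x y => by
    simpa using (le_abs_self _).trans (f.norm_coe_le_norm (x, y)), rfl⟩

theorem exists_lt_dualValue_add (μ : Measure X) (ν : Measure Y) (f : C(X × Y, ℝ))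
    {η : ℝ} (hη : 0 < η) :
    ∃ (φ : C(X, ℝ)) (ψ : C(Y, ℝ)), (∀ x y, f (x, y) ≤ φ x + ψ y) ∧
      ∫ x, φ x ∂μ + ∫ y, ψ y ∂ν < dualValue μ ν f + η := by
  obtain ⟨_, ⟨φ, ψ, h, rfl⟩, hr⟩ := exists_lt_of_csInf_lt (dominatingValues_nonempty μ ν f)
    (lt_add_of_pos_right (dualValue μ ν f) hη)
  exact ⟨φ, ψ, h, hr⟩

theorem integrable_of_continuousMap {Z : Type*} [TopologicalSpace Z] [CompactSpace Z]
    [MeasurableSpace Z] [OpensMeasurableSpace Z] (ρ : Measure Z) [IsFiniteMeasure ρ] (φ : C(Z, ℝ)) :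
    Integrable φ ρ :=
  φ.continuous.integrable_of_hasCompactSupport (HasCompactSupport.of_compactSpace _)

variable [BorelSpace X] [BorelSpace Y]
  (μ : Measure X) (ν : Measure Y) [IsProbabilityMeasure μ] [IsProbabilityMeasure ν]

/-- Integrate in `y` for fixed `x`, then in `x`. This keeps the infimum defining `dualValue` finite.
-/
theorem le_integral_add_integral {m : ℝ} {φ : C(X, ℝ)} {ψ : C(Y, ℝ)}
    (h : ∀ x y, m ≤ φ x + ψ y) : m ≤ ∫ x, φ x ∂μ + ∫ y, ψ y ∂ν := by
  have h1 : ∀ x, m - φ x ≤ ∫ y, ψ y ∂ν := fun x => by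
    have := integral_mono (μ := ν) (integrable_const (m - φ x)) (integrable_of_continuousMap ν ψ)
      (fun y => by linarith [h x y])
    simpa using this
  have := integral_mono (μ := μ) (integrable_const (m - ∫ y, ψ y ∂ν))
    (integrable_of_continuousMap μ φ) (fun x => by linarith [h1 x])
  simp only [integral_const, probReal_univ, smul_eq_mul, one_mul] at this
  linarith

theorem dominatingValues_bddBelow (f : C(X × Y, ℝ)) : BddBelow (dominatingValues μ ν f) := by
  refine ⟨-‖f‖, ?_⟩
  rintro _ ⟨φ, ψ, h, rfl⟩
  exact le_integral_add_integral μ ν fun x y => (neg_le_of_abs_le (f.norm_coe_le_norm _)).trans (h x y)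

theorem dualValue_le {f : C(X × Y, ℝ)} {φ : C(X, ℝ)} {ψ : C(Y, ℝ)}
    (h : ∀ x y, f (x, y) ≤ φ x + ψ y) : dualValue μ ν f ≤ ∫ x, φ x ∂μ + ∫ y, ψ y ∂ν :=
  csInf_le (dominatingValues_bddBelow μ ν f) ⟨φ, ψ, h, rfl⟩

theorem dualValue_add_le (f g : C(X × Y, ℝ)) :
    dualValue μ ν (f + g) ≤ dualValue μ ν f + dualValue μ ν g := by
  refine le_of_forall_pos_le_add fun η hη => ?_
  obtain ⟨φ, ψ, h, hr⟩ := exists_lt_dualValue_add μ ν f (half_pos hη)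
  obtain ⟨φ', ψ', h', hr'⟩ := exists_lt_dualValue_add μ ν g (half_pos hη)
  have := dualValue_le μ ν (f := f + g) (φ := φ + φ') (ψ := ψ + ψ') fun x y => by
    simp only [ContinuousMap.add_apply]; linarith [h x y, h' x y]
  simp only [ContinuousMap.add_apply] at this
  rw [integral_add (integrable_of_continuousMap μ φ) (integrable_of_continuousMap μ φ'),
    integral_add (integrable_of_continuousMap ν ψ) (integrable_of_continuousMap ν ψ')] at this
  linarith

theorem dualValue_smul_le {t : ℝ} (ht : 0 < t) (f : C(X × Y, ℝ)) :
    dualValue μ ν (t • f) ≤ t * dualValue μ ν f := by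
  refine le_of_forall_pos_le_add fun η hη => ?_
  obtain ⟨φ, ψ, h, hr⟩ := exists_lt_dualValue_add μ ν f (div_pos hη ht)
  have := dualValue_le μ ν (f := t • f) (φ := t • φ) (ψ := t • ψ) fun x y => by
    simp only [ContinuousMap.smul_apply, smul_eq_mul]
    nlinarith [h x y]
  simp only [ContinuousMap.smul_apply, smul_eq_mul, integral_const_mul] at this
  have h2 := mul_lt_mul_of_pos_left hr ht
  rw [mul_add, mul_add, mul_div_cancel₀ _ ht.ne'] at h2
  linarith

theorem dualValue_smul {t : ℝ} (ht : 0 < t) (f : C(X × Y, ℝ)) :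
    dualValue μ ν (t • f) = t * dualValue μ ν f := by
  refine (dualValue_smul_le μ ν ht f).antisymm ?_
  have := dualValue_smul_le μ ν (inv_pos.2 ht) (t • f)
  rw [inv_smul_smul₀ ht.ne'] at this
  rwa [← le_inv_mul_iff₀ ht]

theorem dualValue_zero : dualValue μ ν (0 : C(X × Y, ℝ)) = 0 := by
  have := dualValue_smul μ ν (two_pos (α := ℝ)) (0 : C(X × Y, ℝ))
  rw [smul_zero] at this
  linarith

/-- Hahn–Banach: the functional `t • c ↦ t * dualValue c` on the line through `c` is extended below
the sublinear `dualValue`. -/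
theorem exists_linearMap_le_dualValue (c : C(X × Y, ℝ)) :
    ∃ L : C(X × Y, ℝ) →ₗ[ℝ] ℝ, L c = dualValue μ ν c ∧ ∀ f, L f ≤ dualValue μ ν f := by
  have hz : ∀ t : ℝ, t • c = 0 → t • dualValue μ ν c = 0 := fun t ht => by
    rcases smul_eq_zero.1 ht with h | h
    · simp [h]
    · simp [h, dualValue_zero]
  obtain ⟨L, hL, hle⟩ := exists_extension_of_le_sublinear
    (LinearPMap.mkSpanSingleton' c (dualValue μ ν c) hz) (dualValue μ ν)
    (fun t ht f => dualValue_smul μ ν ht f) (dualValue_add_le μ ν) (by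
      rintro ⟨f, hf⟩
      obtain ⟨t, rfl⟩ := Submodule.mem_span_singleton.1 hf
      rw [LinearPMap.mkSpanSingleton'_apply, smul_eq_mul, RingHom.id_apply]
      rcases lt_trichotomy t 0 with ht | rfl | ht
      -- For negative `t`, subadditivity applied to `t • c + (-t) • c = 0` gives the required
      -- inequality.
      · have h1 := dualValue_add_le μ ν (t • c) ((-t) • c)
        rw [← add_smul, add_neg_cancel, zero_smul, dualValue_zero,
          dualValue_smul μ ν (neg_pos.2 ht)] at h1
        change _ ≤ dualValue μ ν (t • c)
        linarith
      · simp [dualValue_zero]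
      · exact (dualValue_smul μ ν ht c).ge)
  refine ⟨L, ?_, hle⟩
  exact (hL ⟨c, Submodule.mem_span_singleton_self c⟩).trans
    (LinearPMap.mkSpanSingleton'_apply_self ..)

/-- A functional below the dual value is integration against a coupling. -/
theorem exists_coupling_of_le_dualValue (L : C(X × Y, ℝ) →ₗ[ℝ] ℝ)
    (hL : ∀ f, L f ≤ dualValue μ ν f) :
    ∃ γ : Measure (X × Y), γ ∈ couplings μ ν ∧ ∀ f : C(X × Y, ℝ), ∫ z, f z ∂γ = L f := by
  have hneg : ∀ f : C(X × Y, ℝ), (∀ z, f z ≤ 0) → L f ≤ 0 := fun f hf =>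
    (hL f).trans <| by
      simpa using dualValue_le μ ν (f := f) (φ := 0) (ψ := 0) (fun x y => by simpa using hf (x, y))
  let e : C_c(X × Y, ℝ) →ₗ[ℝ] C(X × Y, ℝ) :=
    { toFun := fun f => f.toContinuousMap
      map_add' := fun _ _ => rfl
      map_smul' := fun _ _ => rfl }
  let Λ : C_c(X × Y, ℝ) →ₚ[ℝ] ℝ := PositiveLinearMap.mk₀ (L ∘ₗ e) (by
    intro f hf
    have := hneg (-(e f)) fun z => neg_nonpos.2 (hf z)
    rw [map_neg] at this
    simpa using this)
  let γ := RealRMK.rieszMeasure Λ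
  have hint : ∀ f : C(X × Y, ℝ), ∫ z, f z ∂γ = L f := fun f =>
    RealRMK.integral_rieszMeasure Λ ⟨f, HasCompactSupport.of_compactSpace _⟩
  have hle : ∀ (φ : C(X, ℝ)) (ψ : C(Y, ℝ)),
      L (φ.comp ContinuousMap.fst + ψ.comp ContinuousMap.snd) ≤
        ∫ x, φ x ∂μ + ∫ y, ψ y ∂ν := fun φ ψ =>
    (hL _).trans (dualValue_le μ ν fun x y => le_rfl)
  have heq : ∀ (φ : C(X, ℝ)) (ψ : C(Y, ℝ)),
      L (φ.comp ContinuousMap.fst + ψ.comp ContinuousMap.snd) =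
        ∫ x, φ x ∂μ + ∫ y, ψ y ∂ν := fun φ ψ => by
    refine (hle φ ψ).antisymm ?_
    -- The upper bound for the opposite potentials is the lower bound for these, so the marginals
    -- are exact.
    have h := hle (-φ) (-ψ)
    have h2 : (-φ).comp ContinuousMap.fst + (-ψ).comp ContinuousMap.snd =
      -(φ.comp (ContinuousMap.fst : C(X × Y, X)) + ψ.comp ContinuousMap.snd) := by
      ext z; simp; ring
    rw [h2, map_neg] at h
    simp only [ContinuousMap.neg_apply, integral_neg] at h
    linarith
  have hfin : IsFiniteMeasure γ := ⟨isCompact_univ.measure_lt_top⟩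
  refine ⟨γ, ⟨?_, ?_⟩, hint⟩
  · refine ext_of_forall_integral_eq_of_IsFiniteMeasure fun φ => ?_
    rw [integral_map measurable_fst.aemeasurable (by fun_prop)]
    have := heq φ.toContinuousMap 0
    rw [← hint] at this
    simpa using this
  · refine ext_of_forall_integral_eq_of_IsFiniteMeasure fun ψ => ?_
    rw [integral_map measurable_snd.aemeasurable (by fun_prop)]
    have := heq 0 ψ.toContinuousMap
    rw [← hint] at this
    simpa using this

/-- **Kantorovich duality** on compact spaces, with an optimal coupling and almost optimal
potentials. -/
theorem exists_coupling_forall_exists_potentials (c : C(X × Y, ℝ)) :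
    ∃ γ ∈ couplings μ ν, ∀ η : ℝ, 0 < η → ∃ (φ : C(X, ℝ)) (ψ : C(Y, ℝ)),
      (∀ x y, φ x + ψ y ≤ c (x, y)) ∧
        ∫ z, c z ∂γ - η ≤ ∫ x, φ x ∂μ + ∫ y, ψ y ∂ν := by
  obtain ⟨L, hLc, hL⟩ := exists_linearMap_le_dualValue μ ν (-c)
  obtain ⟨γ, hγ, hint⟩ := exists_coupling_of_le_dualValue μ ν L hL
  refine ⟨γ, hγ, fun η hη => ?_⟩
  obtain ⟨φ, ψ, h, hr⟩ := exists_lt_dualValue_add μ ν (-c) hη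
  refine ⟨-φ, -ψ, fun x y => ?_, ?_⟩
  · have := h x y
    simp only [ContinuousMap.neg_apply] at this ⊢
    linarith
  · rw [← hLc, ← hint] at hr
    simp only [ContinuousMap.neg_apply, integral_neg] at hr ⊢
    linarith

end Duality

/-! ### Relative entropy and couplings -/

/-- The variational lower bound of Donsker and Varadhan for the relative entropy. -/
theorem integral_sub_log_integral_exp_le_klDiv {Z : Type*} [MeasurableSpace Z] {γ ρ : Measure Z}
    [IsProbabilityMeasure γ] [IsProbabilityMeasure ρ] {f : Z → ℝ} (hf : Integrable f γ)
    (hexp : Integrable (fun z => Real.exp (f z)) ρ) (h : InformationTheory.klDiv γ ρ ≠ ∞) :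
    ∫ z, f z ∂γ - Real.log (∫ z, Real.exp (f z) ∂ρ) ≤ (InformationTheory.klDiv γ ρ).toReal := by
  obtain ⟨hac, hint⟩ := InformationTheory.klDiv_ne_top_iff.1 h
  have : IsProbabilityMeasure (ρ.tilted f) := isProbabilityMeasure_tilted hexp
  have hac' : γ ≪ ρ.tilted f := hac.trans (absolutelyContinuous_tilted hexp)
  -- Gibbs' inequality: the entropy of `γ` relative to the tilted measure is nonnegative; expanding
  -- its log-likelihood ratio gives the bound.
  have h1 := InformationTheory.integral_llr_add_sub_measure_univ_nonneg hac'
    (integrable_llr_tilted_right hac hf hint hexp)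
  rw [integral_llr_tilted_right hac hf hexp hint] at h1
  rw [InformationTheory.toReal_klDiv hac hint]
  simp only [probReal_univ] at h1 ⊢
  linarith

theorem isProbabilityMeasure_of_mem_couplings {X Y : Type*} [MeasurableSpace X]
    [MeasurableSpace Y] {μ : Measure X} {ν : Measure Y} [IsProbabilityMeasure μ] {γ : Measure (X × Y)}
    (hγ : γ ∈ couplings μ ν) : IsProbabilityMeasure γ := by
  have : IsProbabilityMeasure (γ.map Prod.fst) := by rw [hγ.1]; infer_instance
  exact Measure.isProbabilityMeasure_of_map Prod.fst

theorem prod_mem_couplings {X Y : Type*} [MeasurableSpace X] [MeasurableSpace Y]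
    {μ : Measure X} {ν : Measure Y} [IsProbabilityMeasure μ] [IsProbabilityMeasure ν] :
    μ.prod ν ∈ couplings μ ν :=
  ⟨by simp, by simp⟩

/-! ### Duality for compactly supported measures -/

section Support

variable {X Y : Type*} [MetricSpace X] [SecondCountableTopology X] [MeasurableSpace X]
  [MetricSpace Y] [SecondCountableTopology Y] [MeasurableSpace Y]
  {μ : Measure X} {ν : Measure Y}

theorem restrict_support_prod_eq_self {γ : Measure (X × Y)} (hγ : γ ∈ couplings μ ν) :
    γ.restrict (μ.support ×ˢ ν.support) = γ := by
  refine Measure.restrict_eq_self_of_ae_mem ?_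
  have h1 : ∀ᵐ z ∂γ, z.1 ∈ μ.support :=
    ae_of_ae_map (f := Prod.fst) measurable_fst.aemeasurable (by
      rw [hγ.1]; exact Measure.support_mem_ae)
  have h2 : ∀ᵐ z ∂γ, z.2 ∈ ν.support :=
    ae_of_ae_map (f := Prod.snd) measurable_snd.aemeasurable (by
      rw [hγ.2]; exact Measure.support_mem_ae)
  filter_upwards [h1, h2] with z hz1 hz2 using ⟨hz1, hz2⟩

theorem restrict_support_eq_self : μ.restrict μ.support = μ :=
  Measure.restrict_eq_self_of_ae_mem (s := μ.support) Measure.support_mem_ae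

variable [BorelSpace X] [BorelSpace Y]

theorem integrable_of_mem_couplings [IsProbabilityMeasure μ] (hμ : IsCompact μ.support)
    (hν : IsCompact ν.support) {γ : Measure (X × Y)} (hγ : γ ∈ couplings μ ν) {f : X × Y → ℝ}
    (hf : Continuous f) : Integrable f γ := by
  have := isProbabilityMeasure_of_mem_couplings hγ
  have := hf.continuousOn.integrableOn_compact (μ := γ) (hμ.prod hν)
  rwa [IntegrableOn, restrict_support_prod_eq_self hγ] at this

theorem map_comap_support : (μ.comap ((↑) : μ.support → X)).map (↑) = μ := by
  rw [map_comap_subtype_coe Measure.isClosed_support.measurableSet,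
    restrict_support_eq_self]

/-- **Kantorovich duality** for compactly supported measures and a continuous cost. -/
theorem exists_coupling_forall_exists_continuous_potentials
    [IsProbabilityMeasure μ] [IsProbabilityMeasure ν]
    (hμ : IsCompact μ.support) (hν : IsCompact ν.support) {c : X × Y → ℝ} (hc : Continuous c) :
    ∃ γ ∈ couplings μ ν, ∀ η : ℝ, 0 < η → ∃ (φ : C(X, ℝ)) (ψ : C(Y, ℝ)),
      (∀ x ∈ μ.support, ∀ y ∈ ν.support, φ x + ψ y ≤ c (x, y)) ∧
        ∫ z, c z ∂γ - η ≤ ∫ x, φ x ∂μ + ∫ y, ψ y ∂ν := by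
  have := isCompact_iff_compactSpace.1 hμ
  have := isCompact_iff_compactSpace.1 hν
  have eμ := MeasurableEmbedding.subtype_coe (Measure.isClosed_support (μ := μ)).measurableSet
  have eν := MeasurableEmbedding.subtype_coe (Measure.isClosed_support (μ := ν)).measurableSet
  have e := eμ.prodMap eν
  set μ' : Measure μ.support := μ.comap Subtype.val
  set ν' : Measure ν.support := ν.comap Subtype.val
  have hmμ : μ'.map Subtype.val = μ := map_comap_support
  have hmν : ν'.map Subtype.val = ν := map_comap_support
  have : IsProbabilityMeasure (μ'.map Subtype.val) := by rw [hmμ]; infer_instance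
  have : IsProbabilityMeasure μ' := Measure.isProbabilityMeasure_of_map Subtype.val
  have : IsProbabilityMeasure (ν'.map Subtype.val) := by rw [hmν]; infer_instance
  have : IsProbabilityMeasure ν' := Measure.isProbabilityMeasure_of_map Subtype.val
  obtain ⟨γ, hγ, h⟩ := exists_coupling_forall_exists_potentials μ' ν'
    ⟨fun z => c (z.1, z.2), by fun_prop⟩
  refine ⟨γ.map (Prod.map Subtype.val Subtype.val), ⟨?_, ?_⟩, fun η hη => ?_⟩
  · rw [Measure.map_map measurable_fst e.measurable, Prod.map_fst',
      ← Measure.map_map eμ.measurable measurable_fst, hγ.1, hmμ]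
  · rw [Measure.map_map measurable_snd e.measurable, Prod.map_snd',
      ← Measure.map_map eν.measurable measurable_snd, hγ.2, hmν]
  · obtain ⟨φ, ψ, hle, hint⟩ := h η hη
    -- Tietze extension; the domination by `c` is kept only on the supports.
    obtain ⟨φ', hφ'⟩ := φ.exists_restrict_eq Measure.isClosed_support
    obtain ⟨ψ', hψ'⟩ := ψ.exists_restrict_eq Measure.isClosed_support
    have hφ : ∀ x : μ.support, φ' x = φ x := fun x => by rw [← hφ']; rfl
    have hψ : ∀ y : ν.support, ψ' y = ψ y := fun y => by rw [← hψ']; rfl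
    refine ⟨φ', ψ', fun x hx y hy => ?_, ?_⟩
    · have := hle ⟨x, hx⟩ ⟨y, hy⟩
      rwa [← hφ, ← hψ] at this
    · have h1 : ∫ x, φ' x ∂μ = ∫ x, φ x ∂μ' := by
        rw [← funext hφ, ← eμ.integral_map, hmμ]
      have h2 : ∫ y, ψ' y ∂ν = ∫ y, ψ y ∂ν' := by
        rw [← funext hψ, ← eν.integral_map, hmν]
      rw [e.integral_map, h1, h2]
      exact hint

end Support

/-! ### The mixed second derivative -/

/-- Near a point where `c` is `C²`, its second-order cross difference is given by the mixed second
derivative up to a small multiple of the product of the increments. -/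
theorem exists_cross_difference_bound {E F : Type*} [NormedAddCommGroup E] [NormedSpace ℝ E]
    [NormedAddCommGroup F] [NormedSpace ℝ F] {c : E × F → ℝ} {x₀ : E} {y₀ : F}
    (hc : ContDiffAt ℝ 2 c (x₀, y₀)) {δ : ℝ} (hδ : 0 < δ) :
    ∃ r > 0, ∀ x ∈ Metric.ball x₀ r, ∀ x' ∈ Metric.ball x₀ r, ∀ y ∈ Metric.ball y₀ r,
      ∀ y' ∈ Metric.ball y₀ r,
      |c (x, y) + c (x', y') - c (x', y) - c (x, y') -
        fderiv ℝ (fderiv ℝ c) (x₀, y₀) (x - x', 0) (0, y - y')| ≤ δ * ‖x - x'‖ * ‖y - y'‖ := by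
  set H := fderiv ℝ (fderiv ℝ c) (x₀, y₀) with hH
  have hd : ∀ᶠ z in 𝓝 (x₀, y₀), DifferentiableAt ℝ c z ∧ DifferentiableAt ℝ (fderiv ℝ c) z := by
    filter_upwards [hc.eventually (by simp)] with z hz
    exact ⟨hz.differentiableAt (by simp),
      (hz.fderiv_right (m := 1) (by norm_num)).differentiableAt (by simp)⟩
  have hcont :=
    ((hc.fderiv_right (m := 1) (by norm_num)).fderiv_right (m := 0) (by norm_num)).continuousAt
  have hclose : ∀ᶠ z in 𝓝 (x₀, y₀), dist (fderiv ℝ (fderiv ℝ c) z) H < δ :=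
    Metric.continuousAt_iff'.1 hcont δ hδ
  obtain ⟨r, hr, hball⟩ := Metric.eventually_nhds_iff_ball.1
    (hd.and hclose)
  have hmem : ∀ x ∈ Metric.ball x₀ r, ∀ y ∈ Metric.ball y₀ r, (x, y) ∈ Metric.ball (x₀, y₀) r :=
    fun x hx y hy => by rw [← ball_prod_same]; exact ⟨hx, hy⟩
  refine ⟨r, hr, fun x hx x' hx' y hy y' hy' => ?_⟩
  have h1 : ∀ y ∈ Metric.ball y₀ r,
      ‖fderiv ℝ c (x, y) - fderiv ℝ c (x', y) - H (x - x', 0)‖ ≤ δ * ‖x - x'‖ := fun y hy => by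
    -- Mean value inequality in `x` for `fderiv ℝ c - H`, whose derivative has norm at most `δ`. A
    -- second one, in `y`, then gives the product of the increments.
    have := (convex_ball (x₀, y₀) r).norm_image_sub_le_of_norm_hasFDerivWithin_le
      (f := fun z => fderiv ℝ c z - H z) (f' := fun z => fderiv ℝ (fderiv ℝ c) z - H) (C := δ)
      (fun z hz => ((hball z hz).1.2.hasFDerivAt.sub H.hasFDerivAt).hasFDerivWithinAt)
      (fun z hz => by rw [← dist_eq_norm]; exact (hball z hz).2.le)
      (hmem x' hx' y hy) (hmem x hx y hy)
    have h2 : (x - x', (0 : F)) = (x, y) - (x', y) := by simp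
    rw [h2]
    have h3 : ‖(x, y) - (x', y)‖ = ‖x - x'‖ := by simp [Prod.norm_def]
    rw [h3] at this
    rw [sub_sub_sub_comm] at this
    rwa [map_sub]
  have hder : ∀ x ∈ Metric.ball x₀ r, ∀ y ∈ Metric.ball y₀ r,
      HasFDerivAt (fun y => c (x, y)) (fderiv ℝ c (x, y) ∘L .inr ℝ E F) y := fun x hx y hy =>
    (hball _ (hmem x hx y hy)).1.1.hasFDerivAt.comp y (hasFDerivAt_prodMk_right x y)
  have := (convex_ball y₀ r).norm_image_sub_le_of_norm_hasFDerivWithin_le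
    (f := fun y => c (x, y) - c (x', y) - H (x - x', 0) (0, y))
    (f' := fun y => (fderiv ℝ c (x, y) - fderiv ℝ c (x', y) - H (x - x', 0)) ∘L .inr ℝ E F)
    (C := δ * ‖x - x'‖)
    (fun y hy => (((hder x hx y hy).sub (hder x' hx' y hy)).sub
      ((H (x - x', 0)) ∘L .inr ℝ E F).hasFDerivAt).hasFDerivWithinAt)
    (fun y hy => (ContinuousLinearMap.opNorm_comp_le _ _).trans
      ((mul_le_of_le_one_right (norm_nonneg _) (ContinuousLinearMap.norm_inr_le_one ℝ E F)).trans
        (h1 y hy))) hy' hy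
  rw [Real.norm_eq_abs] at this
  convert this using 2
  have h2 : ((0 : E), y - y') = (0, y) - (0, y') := by simp
  rw [h2, map_sub]
  ring

/-- The chain rule along the two coordinate embeddings. The outer derivative is the one in `x` on
both sides, so no symmetry of second derivatives is needed. -/
theorem crossHessian_apply {d : ℕ}
    {c : EuclideanSpace ℝ (Fin d) × EuclideanSpace ℝ (Fin d) → ℝ}
    {x y : EuclideanSpace ℝ (Fin d)} (hc : ContDiffAt ℝ 2 c (x, y)) (i j : Fin d) :
    crossHessian c x y i j = fderiv ℝ (fderiv ℝ c) (x, y) (EuclideanSpace.single i 1, 0)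
      (0, EuclideanSpace.single j 1) := by
  have hd : ∀ᶠ x' in 𝓝 x, fderiv ℝ (fun y' => c (x', y')) y (EuclideanSpace.single j 1) =
      fderiv ℝ c (x', y) (0, EuclideanSpace.single j 1) := by
    have ht : Filter.Tendsto (fun x' => (x', y)) (𝓝 x) (𝓝 (x, y)) :=
      (by fun_prop : Continuous fun x' => (x', y)).tendsto x
    filter_upwards [ht.eventually (hc.eventually (by simp))] with x' hx'
    have := (hx'.differentiableAt (by simp)).hasFDerivAt.comp y (hasFDerivAt_prodMk_right x' y)
    have h2 := this.fderiv
    rw [Function.comp_def] at h2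
    rw [h2]
    simp
  have h2 := (hc.fderiv_right (m := 1) (by norm_num)).differentiableAt (by simp)
  have h4 : HasFDerivAt (fun x' => fderiv ℝ c (x', y)) _ x :=
    h2.hasFDerivAt.comp x (hasFDerivAt_prodMk_left x y)
  have h3 := h4.clm_apply
    (hasFDerivAt_const ((0 : EuclideanSpace ℝ (Fin d)), EuclideanSpace.single j (1 : ℝ)) x)
  rw [crossHessian, Matrix.of_apply, Filter.EventuallyEq.fderiv_eq hd]
  rw [h3.fderiv]
  simp

/-- Where the cross Hessian is invertible, a linear change of variables turns the mixed second
derivative into the Euclidean scalar product. -/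
theorem exists_clm_mixed_derivative_eq_norm_sq {d : ℕ}
    {c : EuclideanSpace ℝ (Fin d) × EuclideanSpace ℝ (Fin d) → ℝ}
    {x y : EuclideanSpace ℝ (Fin d)} (hc : ContDiffAt ℝ 2 c (x, y))
    (h : IsUnit (crossHessian c x y)) :
    ∃ T : EuclideanSpace ℝ (Fin d) →L[ℝ] EuclideanSpace ℝ (Fin d), ∀ w,
      fderiv ℝ (fderiv ℝ c) (x, y) (T w, 0) (0, w) = ‖w‖ ^ 2 := by
  set H := fderiv ℝ (fderiv ℝ c) (x, y)
  set M := crossHessian c x y with hM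
  have hB : ∀ u w : EuclideanSpace ℝ (Fin d), H (u, 0) (0, w) = u.ofLp ⬝ᵥ M.mulVec w.ofLp := by
    intro u w
    have hu : (u, (0 : EuclideanSpace ℝ (Fin d))) =
        ∑ i, u i • (EuclideanSpace.single i (1 : ℝ), (0 : EuclideanSpace ℝ (Fin d))) := by
      refine Prod.ext ?_ (by simp [Prod.snd_sum])
      rw [Prod.fst_sum]
      ext k
      simp [Finset.sum_apply, Pi.single_apply]
    have hw : ((0 : EuclideanSpace ℝ (Fin d)), w) =
        ∑ i, w i • ((0 : EuclideanSpace ℝ (Fin d)), EuclideanSpace.single i (1 : ℝ)) := by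
      refine Prod.ext (by simp [Prod.fst_sum]) ?_
      rw [Prod.snd_sum]
      ext k
      simp [Finset.sum_apply, Pi.single_apply]
    rw [hu, map_sum, sum_apply]
    refine Finset.sum_congr rfl fun i _ => ?_
    rw [hw, map_sum, Matrix.mulVec, dotProduct, Finset.mul_sum]
    refine Finset.sum_congr rfl fun j _ => ?_
    rw [hM, crossHessian_apply hc]
    simp only [map_smul, smul_apply, smul_eq_mul]
    ring
  -- With `T = M⁻ᵀ`, the form `T w ⬝ M w` becomes `w ⬝ M⁻¹ M w = ‖w‖²`.
  refine ⟨(Matrix.toEuclideanLin M⁻¹.transpose).toContinuousLinearMap, fun w => ?_⟩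
  rw [hB, EuclideanSpace.real_norm_sq_eq]
  simp only [LinearMap.coe_toContinuousLinearMap', Matrix.toLpLin_apply]
  rw [Matrix.mulVec_transpose, ← Matrix.dotProduct_mulVec, Matrix.mulVec_mulVec,
    Matrix.nonsing_inv_mul _ ((Matrix.isUnit_iff_isUnit_det _).1 h), Matrix.one_mulVec]
  simp [dotProduct, sq]

/-! ### Gaussian bounds for Gibbs integrals -/

/-- A nonnegative function that is quadratically detached from its near-minimizers has a Gibbs
integral of Gaussian size. -/
theorem setLIntegral_exp_neg_div_le {E : Type*} [NormedAddCommGroup E] [InnerProductSpace ℝ E]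
    [FiniteDimensional ℝ E] [MeasurableSpace E] [BorelSpace E] {S : Set E} (hS : MeasurableSet S)
    {f : E → ℝ} (hf : ∀ y ∈ S, 0 ≤ f y)
    (h : ∀ y ∈ S, ∀ y' ∈ S, ‖y - y'‖ ^ 2 / 2 ≤ f y + f y') {ε : ℝ} (hε : 0 < ε) :
    ∫⁻ y in S, ENNReal.ofReal (Real.exp (-f y / ε)) ≤
      ENNReal.ofReal (Real.exp (1 / 2) * (4 * Real.pi) ^ (Module.finrank ℝ E / 2 : ℝ)) *
        ENNReal.ofReal (ε ^ (Module.finrank ℝ E / 2 : ℝ)) := by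
  rcases S.eq_empty_or_nonempty with rfl | hne
  · simp
  have hbdd : BddBelow (f '' S) := ⟨0, by rintro _ ⟨y, hy, rfl⟩; exact hf y hy⟩
  -- A minimizer up to `ε` suffices: `2 f y + ε ≥ ‖y - a‖² / 2`, so the error costs only the factor
  -- `exp (1 / 2)`.
  obtain ⟨_, ⟨a, ha, rfl⟩, hlt⟩ := exists_lt_of_csInf_lt (hne.image f)
    (lt_add_of_pos_right (sInf (f '' S)) hε)
  have hle : ∀ y ∈ S, f a ≤ f y + ε := fun y hy => by
    linarith [csInf_le hbdd (Set.mem_image_of_mem f hy)]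
  have hb : 0 < (4 * ε)⁻¹ := by positivity
  have hpt : ∀ y ∈ S, Real.exp (-f y / ε) ≤
      Real.exp (1 / 2) * Real.exp (-(4 * ε)⁻¹ * ‖y - a‖ ^ 2) := fun y hy => by
    rw [← Real.exp_add]
    refine Real.exp_le_exp.2 ?_
    have h1 := h y hy a ha
    have h2 := hle y hy
    rw [div_le_iff₀ hε]
    have : (1 / 2 + -(4 * ε)⁻¹ * ‖y - a‖ ^ 2) * ε = ε / 2 - ‖y - a‖ ^ 2 / 4 := by
      field_simp
      ring
    rw [this]
    linarith
  calc ∫⁻ y in S, ENNReal.ofReal (Real.exp (-f y / ε))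
      ≤ ∫⁻ y in S, ENNReal.ofReal (Real.exp (1 / 2) * Real.exp (-(4 * ε)⁻¹ * ‖y - a‖ ^ 2)) :=
        setLIntegral_mono' hS fun y hy => ENNReal.ofReal_le_ofReal (hpt y hy)
    _ ≤ ∫⁻ y, ENNReal.ofReal (Real.exp (1 / 2) * Real.exp (-(4 * ε)⁻¹ * ‖y - a‖ ^ 2)) :=
        setLIntegral_le_lintegral _ _
    _ = ∫⁻ y : E, ENNReal.ofReal (Real.exp (1 / 2) * Real.exp (-(4 * ε)⁻¹ * ‖y‖ ^ 2)) :=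
        lintegral_sub_right_eq_self (fun y : E =>
          ENNReal.ofReal (Real.exp (1 / 2) * Real.exp (-(4 * ε)⁻¹ * ‖y‖ ^ 2))) a
    _ = ENNReal.ofReal (∫ y : E, Real.exp (1 / 2) * Real.exp (-(4 * ε)⁻¹ * ‖y‖ ^ 2)) := by
        rw [ofReal_integral_eq_lintegral_ofReal]
        · refine Integrable.const_mul ?_ _
          -- The Gaussian integral has a positive value, whereas a non-integrable function would
          -- have integral `0`.
          by_contra hni
          have h0 := GaussianFourier.integral_rexp_neg_mul_sq_norm (V := E) hb
          rw [integral_undef hni] at h0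
          have : 0 < (Real.pi / (4 * ε)⁻¹) ^ (Module.finrank ℝ E / 2 : ℝ) :=
            Real.rpow_pos_of_pos (by positivity) _
          linarith
        · exact Filter.Eventually.of_forall fun y => by positivity
    _ = _ := by
        rw [integral_const_mul, GaussianFourier.integral_rexp_neg_mul_sq_norm hb,
          ← ENNReal.ofReal_mul (by positivity), mul_assoc, ← Real.mul_rpow (by positivity) hε.le]
        congr 3
        field_simp

theorem HasBoundedDensity.exists_le_smul_volume {d : ℕ} {μ : Measure (EuclideanSpace ℝ (Fin d))}
    (h : HasBoundedDensity μ) : ∃ K : ℝ≥0, μ ≤ K • volume := by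
  obtain ⟨f, hf, -, rfl⟩ := h
  refine ⟨(eLpNorm f ∞ volume).toNNReal, ?_⟩
  rw [← Measure.coe_nnreal_smul, ENNReal.coe_toNNReal hf.eLpNorm_lt_top.ne, ← withDensity_const]
  refine withDensity_mono ?_
  rw [eLpNorm_exponent_top]
  filter_upwards [enorm_ae_le_eLpNormEssSup f volume] with x hx
  exact Real.ofReal_le_enorm _ |>.trans hx

section LocalEstimate

variable {d : ℕ} {c : EuclideanSpace ℝ (Fin d) × EuclideanSpace ℝ (Fin d) → ℝ}
  {X Y : Set (EuclideanSpace ℝ (Fin d))}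

/-- Over `s`, the Gibbs integrals of all the slacks `F = c - φ ⊕ ψ ≥ 0` on `X × Y` are of order
`ε ^ (d / 2)`, with the constant `C`. -/
def GibbsIntegralBound (c : EuclideanSpace ℝ (Fin d) × EuclideanSpace ℝ (Fin d) → ℝ)
    (X Y : Set (EuclideanSpace ℝ (Fin d)))
    (s : Set (EuclideanSpace ℝ (Fin d) × EuclideanSpace ℝ (Fin d))) (C : ℝ≥0) : Prop :=
  ∀ (ε : ℝ) (φ ψ : EuclideanSpace ℝ (Fin d) → ℝ)
    (F : EuclideanSpace ℝ (Fin d) × EuclideanSpace ℝ (Fin d) → ℝ), 0 < ε → Measurable F →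
    (∀ x ∈ X, ∀ y ∈ Y, F (x, y) = c (x, y) - φ x - ψ y ∧ 0 ≤ F (x, y)) →
    ∫⁻ z in s ∩ X ×ˢ Y, ENNReal.ofReal (Real.exp (-F z / ε)) ≤
      C * ENNReal.ofReal (ε ^ ((d : ℝ) / 2))

theorem GibbsIntegralBound.mono {s t : Set (EuclideanSpace ℝ (Fin d) × EuclideanSpace ℝ (Fin d))}
    {C : ℝ≥0} (hst : s ⊆ t) (h : GibbsIntegralBound c X Y t C) : GibbsIntegralBound c X Y s C :=
  fun ε φ ψ F hε hF hF' => (lintegral_mono_set (Set.inter_subset_inter_left _ hst)).trans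
    (h ε φ ψ F hε hF hF')

theorem GibbsIntegralBound.union {s t : Set (EuclideanSpace ℝ (Fin d) × EuclideanSpace ℝ (Fin d))}
    {C D : ℝ≥0} (hs : GibbsIntegralBound c X Y s C) (ht : GibbsIntegralBound c X Y t D) :
    GibbsIntegralBound c X Y (s ∪ t) (C + D) := fun ε φ ψ F hε hF hF' => by
  rw [Set.union_inter_distrib_right, ENNReal.coe_add, add_mul]
  exact (lintegral_union_le _ _ _).trans
    (add_le_add (hs ε φ ψ F hε hF hF') (ht ε φ ψ F hε hF hF'))

/-- The shear `(v, y) ↦ (v + T y, y)` preserves volume and turns the nondegenerate mixed derivative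
into quadratic growth of `F` along each slice of fixed `v`. -/
theorem exists_gibbsIntegralBound_ball (hX : MeasurableSet X) (hY : MeasurableSet Y)
    {x₀ y₀ : EuclideanSpace ℝ (Fin d)} (hc : ContDiffAt ℝ 2 c (x₀, y₀))
    (h : IsUnit (crossHessian c x₀ y₀)) :
    ∃ r > 0, ∃ C, GibbsIntegralBound c X Y (Metric.ball (x₀, y₀) r) C := by
  obtain ⟨T, hT⟩ := exists_clm_mixed_derivative_eq_norm_sq hc h
  obtain ⟨r, hr, hcross⟩ := exists_cross_difference_bound hc
    -- With this `δ`, the error for the increments `T w` and `w` is at most `‖w‖² / 2`, half of the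
    -- main term.
    (δ := 1 / (2 * (‖T‖ + 1))) (by positivity)
  -- Bounds `v = x - T y` for `(x, y)` in the ball; slices with larger `v` are empty.
  set R : ℝ := ‖x₀‖ + r + ‖T‖ * (‖y₀‖ + r) with hR
  set A : ℝ≥0∞ := ENNReal.ofReal (Real.exp (1 / 2) * (4 * Real.pi) ^ ((d : ℝ) / 2)) with hA
  set V : ℝ≥0∞ := volume (Metric.closedBall (0 : EuclideanSpace ℝ (Fin d)) R) with hV
  have hVfin : V ≠ ∞ := measure_closedBall_lt_top.ne
  refine ⟨r, hr, (A * V).toNNReal, fun ε φ ψ F hε hF hF' => ?_⟩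
  rw [ENNReal.coe_toNNReal (ENNReal.mul_ne_top ENNReal.ofReal_ne_top hVfin)]
  set K := Metric.ball (x₀, y₀) r ∩ X ×ˢ Y with hK
  have hKm : MeasurableSet K := measurableSet_ball.inter (hX.prod hY)
  have hKmem : ∀ {x y}, (x, y) ∈ K → x ∈ Metric.ball x₀ r ∧ y ∈ Metric.ball y₀ r ∧ x ∈ X ∧ y ∈ Y :=
    fun {x y} hxy => by
      rw [hK, ← ball_prod_same] at hxy
      exact ⟨hxy.1.1, hxy.1.2, hxy.2.1, hxy.2.2⟩
  set G : EuclideanSpace ℝ (Fin d) × EuclideanSpace ℝ (Fin d) → ℝ≥0∞ :=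
    K.indicator fun z => ENNReal.ofReal (Real.exp (-F z / ε)) with hG
  have hGm : Measurable G := Measurable.indicator (by fun_prop) hKm
  have hshear : Measurable fun p : EuclideanSpace ℝ (Fin d) × EuclideanSpace ℝ (Fin d) =>
      (p.2 + T p.1, p.1) := by fun_prop
  have hslice : ∀ v, ∫⁻ y, G (v + T y, y) ≤
      (Metric.closedBall (0 : EuclideanSpace ℝ (Fin d)) R).indicator
        (fun _ => A * ENNReal.ofReal (ε ^ ((d : ℝ) / 2))) v := by
    intro v
    set S := {y | (v + T y, y) ∈ K} with hS
    have hSm : MeasurableSet S := hKm.preimage (by fun_prop)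
    have hGS : (fun y => G (v + T y, y)) =
        S.indicator fun y => ENNReal.ofReal (Real.exp (-F (v + T y, y) / ε)) := by
      ext y
      by_cases hy : (v + T y, y) ∈ K
      · rw [hG, Set.indicator_of_mem hy, Set.indicator_of_mem (show y ∈ S from hy)]
      · rw [hG, Set.indicator_of_notMem hy, Set.indicator_of_notMem (show y ∉ S from hy)]
    rw [hGS, lintegral_indicator hSm]
    by_cases hv : v ∈ Metric.closedBall (0 : EuclideanSpace ℝ (Fin d)) R
    · rw [Set.indicator_of_mem hv]
      have := setLIntegral_exp_neg_div_le hSm (f := fun y => F (v + T y, y))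
        (fun y hy => (hF' _ (hKmem hy).2.2.1 _ (hKmem hy).2.2.2).2) (fun y hy y' hy' => ?_) hε
      · simpa only [finrank_euclideanSpace_fin] using this
      · obtain ⟨hx1, hy1, hxX, hyY⟩ := hKmem hy
        obtain ⟨hx1', hy1', hxX', hyY'⟩ := hKmem hy'
        have h1 := (abs_le.1 (hcross _ hx1 _ hx1' _ hy1 _ hy1')).1
        have hsub : v + T y - (v + T y') = T (y - y') := by rw [map_sub]; abel
        rw [hsub, hT] at h1
        have h2 : 1 / (2 * (‖T‖ + 1)) * ‖T (y - y')‖ * ‖y - y'‖ ≤ ‖y - y'‖ ^ 2 / 2 := by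
          rw [one_div_mul_eq_div, div_mul_eq_mul_div, div_le_iff₀ (by positivity)]
          have h3 := mul_le_mul_of_nonneg_right (T.le_opNorm (y - y')) (norm_nonneg (y - y'))
          nlinarith [sq_nonneg ‖y - y'‖]
        -- The potentials cancel in the cross difference of `F`; its two subtracted terms are
        -- nonnegative and can be dropped.
        have e1 := (hF' _ hxX _ hyY).1
        have e2 := (hF' _ hxX' _ hyY').1
        have e3 := hF' _ hxX' _ hyY
        have e4 := hF' _ hxX _ hyY'
        linarith [e3.1, e3.2, e4.1, e4.2]
    · have hSe : S = ∅ := by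
        refine Set.eq_empty_of_forall_notMem fun y hy => hv ?_
        obtain ⟨hx1, hy1, -, -⟩ := hKmem hy
        rw [mem_closedBall_zero_iff]
        have n1 : ‖v + T y‖ ≤ ‖x₀‖ + r := by
          have := norm_le_norm_add_norm_sub' (v + T y) x₀
          rw [mem_ball_iff_norm] at hx1
          linarith
        have n2 : ‖y‖ ≤ ‖y₀‖ + r := by
          have := norm_le_norm_add_norm_sub' y y₀
          rw [mem_ball_iff_norm] at hy1
          linarith
        have n3 : ‖v‖ ≤ ‖v + T y‖ + ‖T y‖ := by
          simpa using norm_sub_le (v + T y) (T y)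
        have n4 := T.le_opNorm_of_le n2
        linarith
      simp [hSe]
  calc ∫⁻ z in K, ENNReal.ofReal (Real.exp (-F z / ε))
      = ∫⁻ z, G z := (lintegral_indicator hKm _).symm
    _ = ∫⁻ y, ∫⁻ x, G (x, y) := by
        rw [Measure.volume_eq_prod, lintegral_prod_symm' _ hGm]
    _ = ∫⁻ y, ∫⁻ v, G (v + T y, y) := by
        congr 1 with y
        exact (lintegral_add_right_eq_self (fun x => G (x, y)) (T y)).symm
    _ = ∫⁻ v, ∫⁻ y, G (v + T y, y) :=
        lintegral_lintegral_swap (f := fun y v => G (v + T y, y)) (hGm.comp hshear).aemeasurable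
    _ ≤ ∫⁻ v, (Metric.closedBall (0 : EuclideanSpace ℝ (Fin d)) R).indicator
          (fun _ => A * ENNReal.ofReal (ε ^ ((d : ℝ) / 2))) v := lintegral_mono hslice
    _ = A * V * ENNReal.ofReal (ε ^ ((d : ℝ) / 2)) := by
        rw [lintegral_indicator measurableSet_closedBall, setLIntegral_const]
        ring

/-- Finitely many of the local balls cover `X ×ˢ Y`, and their constants add up. -/
theorem exists_gibbsIntegralBound (hX : IsCompact X) (hY : IsCompact Y)
    (hc : ∀ x ∈ X, ∀ y ∈ Y, ContDiffAt ℝ 2 c (x, y) ∧ IsUnit (crossHessian c x y)) :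
    ∃ C, GibbsIntegralBound c X Y (X ×ˢ Y) C := by
  refine (hX.prod hY).induction_on (p := fun s => ∃ C, GibbsIntegralBound c X Y s C) ?_ ?_ ?_ ?_
  · exact ⟨0, fun ε φ ψ F _ _ _ => by simp⟩
  · rintro s t hst ⟨C, hC⟩
    exact ⟨C, hC.mono hst⟩
  · rintro s t ⟨C, hC⟩ ⟨D, hD⟩
    exact ⟨C + D, hC.union hD⟩
  · rintro ⟨x, y⟩ ⟨hx, hy⟩
    obtain ⟨r, hr, C, hC⟩ := exists_gibbsIntegralBound_ball hX.measurableSet hY.measurableSet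
      (hc x hx y hy).1 (hc x hx y hy).2
    exact ⟨_, mem_nhdsWithin_of_mem_nhds (Metric.ball_mem_nhds _ hr), C, hC⟩

end LocalEstimate

/-! ### From Lebesgue measure to the marginals -/

/-- The Gibbs integral of a nonnegative slack against `μ ⊗ ν` is of order `ε ^ (d / 2)`. -/
theorem exists_log_integral_exp_le {d : ℕ}
    {c : EuclideanSpace ℝ (Fin d) × EuclideanSpace ℝ (Fin d) → ℝ}
    {μ ν : Measure (EuclideanSpace ℝ (Fin d))} [IsProbabilityMeasure μ] [IsProbabilityMeasure ν]
    (hμ : HasBoundedDensity μ) (hν : HasBoundedDensity ν)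
    (hμ_compact : IsCompact μ.support) (hν_compact : IsCompact ν.support)
    (hc : ∀ x ∈ μ.support, ∀ y ∈ ν.support,
      ContDiffAt ℝ 2 c (x, y) ∧ IsUnit (crossHessian c x y)) :
    ∃ m : ℝ, 0 ≤ m ∧ ∀ (ε : ℝ) (φ ψ : EuclideanSpace ℝ (Fin d) → ℝ)
      (F : EuclideanSpace ℝ (Fin d) × EuclideanSpace ℝ (Fin d) → ℝ), 0 < ε → Continuous F →
      (∀ x ∈ μ.support, ∀ y ∈ ν.support, F (x, y) = c (x, y) - φ x - ψ y ∧ 0 ≤ F (x, y)) →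
      Real.log (∫ z, Real.exp (-F z / ε) ∂μ.prod ν) ≤ m + d / 2 * Real.log ε := by
  obtain ⟨K, hK⟩ := hμ.exists_le_smul_volume
  obtain ⟨L, hL⟩ := hν.exists_le_smul_volume
  obtain ⟨C, hC⟩ := exists_gibbsIntegralBound hμ_compact hν_compact hc
  -- The added `1` makes `log D` nonnegative, as required of `m`.
  set D : ℝ := L * K * C + 1 with hD
  refine ⟨Real.log D, Real.log_nonneg (by rw [hD]; linarith [show (0 : ℝ) ≤ L * K * C by positivity]),
    fun ε φ ψ F hε hF hF' => ?_⟩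
  have hint : Integrable (fun z => Real.exp (-F z / ε)) (μ.prod ν) :=
    integrable_of_mem_couplings hμ_compact hν_compact prod_mem_couplings (by fun_prop)
  have hle : μ.prod ν ≤ L • K • (volume : Measure
      (EuclideanSpace ℝ (Fin d) × EuclideanSpace ℝ (Fin d))) := by
    refine (Measure.prod_mono hK hL).trans_eq ?_
    rw [Measure.prod_smul_right, Measure.prod_smul_left, Measure.volume_eq_prod]
  have hbound : ∫⁻ z, ENNReal.ofReal (Real.exp (-F z / ε)) ∂μ.prod ν ≤
      ENNReal.ofReal (D * ε ^ ((d : ℝ) / 2)) := by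
    have h1 := hC ε φ ψ F hε hF.measurable hF'
    rw [Set.inter_self] at h1
    calc ∫⁻ z, ENNReal.ofReal (Real.exp (-F z / ε)) ∂μ.prod ν
        = ∫⁻ z in μ.support ×ˢ ν.support, ENNReal.ofReal (Real.exp (-F z / ε)) ∂μ.prod ν := by
          rw [restrict_support_prod_eq_self prod_mem_couplings]
      _ ≤ ∫⁻ z in μ.support ×ˢ ν.support, ENNReal.ofReal (Real.exp (-F z / ε)) ∂(L • K • volume) :=
          lintegral_mono' (Measure.restrict_mono le_rfl hle) le_rfl
      _ = L * (K * ∫⁻ z in μ.support ×ˢ ν.support, ENNReal.ofReal (Real.exp (-F z / ε))) := by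
          rw [Measure.restrict_smul, Measure.restrict_smul, lintegral_smul_measure,
            lintegral_smul_measure]
          simp [ENNReal.smul_def]
      _ ≤ L * (K * (C * ENNReal.ofReal (ε ^ ((d : ℝ) / 2)))) := by gcongr
      _ = ENNReal.ofReal (L * K * C) * ENNReal.ofReal (ε ^ ((d : ℝ) / 2)) := by
          rw [ENNReal.ofReal_mul (by positivity), ENNReal.ofReal_mul (by positivity)]
          simp only [ENNReal.ofReal_coe_nnreal]
          ring
      _ ≤ ENNReal.ofReal D * ENNReal.ofReal (ε ^ ((d : ℝ) / 2)) := by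
          gcongr
          linarith
      _ = _ := (ENNReal.ofReal_mul (by positivity)).symm
  rw [← ofReal_integral_eq_lintegral_ofReal hint
    (Filter.Eventually.of_forall fun z => (Real.exp_pos _).le),
    ENNReal.ofReal_le_ofReal_iff (by positivity)] at hbound
  have hDpos : 0 < D := by positivity
  calc Real.log (∫ z, Real.exp (-F z / ε) ∂μ.prod ν) ≤ Real.log (D * ε ^ ((d : ℝ) / 2)) :=
        Real.log_le_log (integral_exp_pos hint) hbound
    _ = Real.log D + d / 2 * Real.log ε := by
        rw [Real.log_mul hDpos.ne' (Real.rpow_pos_of_pos hε _).ne', Real.log_rpow hε]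

end EntropicOT

/-! ### The entropic lower bound -/

theorem mainTheorem7 (d : ℕ) (Ωm Ωp : Set (EuclideanSpace ℝ (Fin d)))
    (hΩm : IsOpen Ωm) (hΩp : IsOpen Ωp) (hΩm_convex : Convex ℝ Ωm) (hΩp_convex : Convex ℝ Ωp)
    (c : EuclideanSpace ℝ (Fin d) × EuclideanSpace ℝ (Fin d) → ℝ)
    (hc : ContDiffOn ℝ 2 c (Ωm ×ˢ Ωp))
    (hc_twist : EntropicOT.InfinitesimallyTwisted c Ωm Ωp)
    (μm μp : Measure (EuclideanSpace ℝ (Fin d)))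
    [IsProbabilityMeasure μm] [IsProbabilityMeasure μp]
    (hμm : EntropicOT.HasBoundedDensity μm) (hμp : EntropicOT.HasBoundedDensity μp)
    (hμm_compact : IsCompact μm.support) (hμp_compact : IsCompact μp.support)
    (hμm_subset : μm.support ⊆ Ωm) (hμp_subset : μp.support ⊆ Ωp) :
    ∃ m : ℝ, 0 ≤ m ∧ ∀ ε : ℝ, 0 < ε →
      EntropicOT.transportCost c μm μp +
          ((((d : ℝ) / 2) * ε * Real.log (1 / ε) - m * ε : ℝ) : EReal) ≤
        EntropicOT.entropicCost c μm μp ε := by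
  open EntropicOT in
  have hsupp : MeasurableSet (μm.support ×ˢ μp.support) :=
    Measure.isClosed_support.measurableSet.prod Measure.isClosed_support.measurableSet
  have hcd : ∀ x ∈ μm.support, ∀ y ∈ μp.support,
      ContDiffAt ℝ 2 c (x, y) ∧ IsUnit (crossHessian c x y) := fun x hx y hy =>
    ⟨hc.contDiffAt ((hΩm.prod hΩp).mem_nhds ⟨hμm_subset hx, hμp_subset hy⟩),
      hc_twist x (hμm_subset hx) y (hμp_subset hy)⟩
  -- Off `Ωm ×ˢ Ωp` the cost is arbitrary. It is replaced by a globally continuous extension from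
  -- the product of the supports, which carries every coupling.
  obtain ⟨c', hc'⟩ := ContinuousMap.exists_restrict_eq
    (Measure.isClosed_support.prod Measure.isClosed_support)
    (⟨_, (hc.continuousOn.mono (Set.prod_mono hμm_subset hμp_subset)).domRestrict⟩ :
      C(μm.support ×ˢ μp.support, ℝ))
  have hcc : ∀ z ∈ μm.support ×ˢ μp.support, c z = c' z := fun z hz =>
    (DFunLike.congr_fun hc' ⟨z, hz⟩).symm
  have hint : ∀ γ ∈ couplings μm μp,
      ∫ z in μm.support ×ˢ μp.support, c z ∂γ = ∫ z, c' z ∂γ := fun γ hγ => by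
    rw [setIntegral_congr_fun hsupp hcc, restrict_support_prod_eq_self hγ]
  obtain ⟨m, hm, hlog⟩ := exists_log_integral_exp_le hμm hμp hμm_compact hμp_compact hcd
  obtain ⟨γ₀, hγ₀, hdual⟩ := exists_coupling_forall_exists_continuous_potentials
    hμm_compact hμp_compact c'.continuous
  refine ⟨m, hm, fun ε hε => le_iInf₂ fun γ hγ => ?_⟩
  have hT : transportCost c μm μp ≤ ((∫ z, c' z ∂γ₀ : ℝ) : EReal) := by
    rw [← hint γ₀ hγ₀]
    exact iInf₂_le γ₀ hγ₀
  rw [hint γ hγ]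
  by_cases hkl : InformationTheory.klDiv γ (μm.prod μp) = ∞
  · rw [hkl, EReal.coe_ennreal_top, EReal.coe_mul_top_of_pos hε, EReal.coe_add_top]
    exact le_top
  have := isProbabilityMeasure_of_mem_couplings hγ
  have key : ∫ z, c' z ∂γ₀ + ((d : ℝ) / 2 * ε * Real.log (1 / ε) - m * ε) ≤
      ∫ z, c' z ∂γ + ε * (InformationTheory.klDiv γ (μm.prod μp)).toReal := by
    -- The potentials depend on `η`, but `m` does not, so `η` can be sent to `0`.
    refine le_of_forall_pos_le_add fun η hη => ?_
    obtain ⟨φ, ψ, hle, hval⟩ := hdual η hη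
    have hI : ∀ {γ}, γ ∈ couplings μm μp → ∀ {f}, Continuous f → Integrable f γ :=
      fun hγ _ hf => integrable_of_mem_couplings hμm_compact hμp_compact hγ hf
    have hF := hlog ε φ ψ (fun z => c' z - φ z.1 - ψ z.2) hε (by fun_prop) fun x hx y hy =>
      ⟨by rw [hcc (x, y) ⟨hx, hy⟩], by linarith [hle x hx y hy]⟩
    have hG := integral_sub_log_integral_exp_le_klDiv
      (hI hγ (f := fun z => -(c' z - φ z.1 - ψ z.2) / ε) (by fun_prop))
      (hI prod_mem_couplings (by fun_prop)) hkl
    have h1 : ∫ z, φ z.1 ∂γ = ∫ x, φ x ∂μm := by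
      rw [← hγ.1, integral_map measurable_fst.aemeasurable (by fun_prop)]
    have h2 : ∫ z, ψ z.2 ∂γ = ∫ y, ψ y ∂μp := by
      rw [← hγ.2, integral_map measurable_snd.aemeasurable (by fun_prop)]
    rw [integral_div, integral_neg,
      integral_sub (hI hγ (f := fun z => c' z - φ z.1) (by fun_prop)) (hI hγ (by fun_prop)),
      integral_sub (hI hγ (by fun_prop)) (hI hγ (by fun_prop)), h1, h2] at hG
    have hG' := mul_le_mul_of_nonneg_left hG hε.le
    rw [mul_sub, mul_div_cancel₀ _ hε.ne'] at hG'
    have hF' := mul_le_mul_of_nonneg_left hF hε.le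
    rw [one_div, Real.log_inv]
    linarith
  have hkl' : ((InformationTheory.klDiv γ (μm.prod μp) : ℝ≥0∞) : EReal) =
      (((InformationTheory.klDiv γ (μm.prod μp)).toReal : ℝ) : EReal) :=
    (EReal.coe_ennreal_toReal hkl).symm
  rw [hkl', ← EReal.coe_mul, ← EReal.coe_add]
  refine (add_le_add_left hT _).trans ?_
  rw [← EReal.coe_add]
  exact EReal.coe_le_coe_iff.2 key
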